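/- Let $M$ be a smooth $d$-manifold ($d\ge 0$; Hausdorff, second countable, without boundary, not necessarily compact or connected) with a smooth Riemannian metric. A \emph{Parseval frame of size $n$} on $TM$ is an $n$-tuple of smooth vector fields $\sigma_1,\dots,\sigma_n$ on $M$ such that $\sum_{j=1}^n\langle v,\sigma_j(p)\rangle\,\sigma_j(p)=v$ for all $p\in M$ and $v\in T_pM$. The manifold $M$ is \emph{stably parallelizable} if the Whitney sum $TM\oplus\mathbb{R}$ of $TM$ with the trivial line bundle is a trivial (smooth) vector bundle. 1. If $M$ is stably parallelizable (and hence orientable), then $TM$ admits a Parseval frame of size $d+1$. 2. Conversely, if the singular cohomology group $H^1(M;\mathbb{Z}/2\mathbb{Z})$ vanishes (so that $M$ is again orientable) and $TM$ admits a Parseval frame of size $d+1$, then $M$ is stably parallelizable. -/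

import Mathlib

open scoped Manifold ContDiff Bundle

noncomputable section

/-! ### Singular cohomology -/

/-- The singular `n`-simplices of a space `X`: continuous maps from the standard `n`-simplex. -/
abbrev SingularSimplex (n : ℕ) (X : Type*) [TopologicalSpace X] : Type _ :=
  C(stdSimplex ℝ (Fin (n + 1)), X)

/-- The inclusion of the `i`-th face (opposite to the `i`-th vertex) of the standard
`(n + 1)`-simplex. -/
def stdSimplexFace (n : ℕ) (i : Fin (n + 2)) :
    C(stdSimplex ℝ (Fin (n + 1)), stdSimplex ℝ (Fin (n + 2))) :=
  ⟨stdSimplex.map i.succAbove, stdSimplex.continuous_map i.succAbove⟩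

/-- Singular `n`-cochains of `X` with coefficients in `R`: functions on the singular `n`-simplices,
that is, homomorphisms from the free group on the singular `n`-simplices to `R`. -/
abbrev SingularCochain (R : Type*) (X : Type*) [TopologicalSpace X] (n : ℕ) : Type _ :=
  SingularSimplex n X → R

/-- The singular coboundary `(δ φ) σ = ∑ i, (-1) ^ i * φ (σ ∘ i-th face)`. -/
def singularCoboundary (R : Type*) [CommRing R] (X : Type*) [TopologicalSpace X] (n : ℕ) :
    SingularCochain R X n →ₗ[R] SingularCochain R X (n + 1) where
  toFun φ σ := ∑ i : Fin (n + 2), (-1 : R) ^ (i : ℕ) * φ (σ.comp (stdSimplexFace n i))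
  map_add' φ ψ := by
    funext σ
    simp [mul_add, Finset.sum_add_distrib]
  map_smul' c φ := by
    funext σ
    simp [Finset.mul_sum, mul_left_comm]

/-- Singular coboundaries of degree `n`: the image of the coboundary map from degree `n - 1`
(zero in degree `0`). -/
def singularCoboundaries (R : Type*) [CommRing R] (X : Type*) [TopologicalSpace X] :
    (n : ℕ) → Submodule R (SingularCochain R X n)
  | 0 => ⊥
  | n + 1 => LinearMap.range (singularCoboundary R X n)

/-- Singular cocycles of degree `n`. -/
def singularCocycles (R : Type*) [CommRing R] (X : Type*) [TopologicalSpace X] (n : ℕ) :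
    Submodule R (SingularCochain R X n) :=
  LinearMap.ker (singularCoboundary R X n)

/-- The `n`-th singular cohomology `H^n(X; R)`: cocycles modulo coboundaries. -/
abbrev SingularCohomology (R : Type*) [CommRing R] (X : Type*) [TopologicalSpace X] (n : ℕ) :
    Type _ :=
  singularCocycles R X n ⧸ (singularCoboundaries R X n).comap (singularCocycles R X n).subtype

/-! ### Trivial bundles and stable parallelizability -/

/-- A smooth isomorphism (over the identity of `M`) between smooth real vector bundles `V₁` and
`V₂` over `M`, with model fibers `F₁` and `F₂`. -/
structure SmoothVectorBundleIso {B H M : Type*} [NormedAddCommGroup B] [NormedSpace ℝ B]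
    [TopologicalSpace H] (I : ModelWithCorners ℝ B H) [TopologicalSpace M] [ChartedSpace H M]
    (F₁ : Type*) [NormedAddCommGroup F₁] [NormedSpace ℝ F₁]
    (V₁ : M → Type*) [TopologicalSpace (Bundle.TotalSpace F₁ V₁)] [∀ x, TopologicalSpace (V₁ x)]
    [∀ x, AddCommGroup (V₁ x)] [∀ x, Module ℝ (V₁ x)] [FiberBundle F₁ V₁] [VectorBundle ℝ F₁ V₁]
    (F₂ : Type*) [NormedAddCommGroup F₂] [NormedSpace ℝ F₂]
    (V₂ : M → Type*) [TopologicalSpace (Bundle.TotalSpace F₂ V₂)] [∀ x, TopologicalSpace (V₂ x)]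
    [∀ x, AddCommGroup (V₂ x)] [∀ x, Module ℝ (V₂ x)] [FiberBundle F₂ V₂]
    [VectorBundle ℝ F₂ V₂] where
  /-- The linear isomorphisms between the fibers. -/
  fiberEquiv : ∀ x : M, V₁ x ≃ₗ[ℝ] V₂ x
  contMDiff_toFun : ContMDiff (I.prod 𝓘(ℝ, F₁)) (I.prod 𝓘(ℝ, F₂)) ∞
    (fun p : Bundle.TotalSpace F₁ V₁ =>
      (⟨p.proj, fiberEquiv p.proj p.snd⟩ : Bundle.TotalSpace F₂ V₂))
  contMDiff_invFun : ContMDiff (I.prod 𝓘(ℝ, F₂)) (I.prod 𝓘(ℝ, F₁)) ∞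
    (fun p : Bundle.TotalSpace F₂ V₂ =>
      (⟨p.proj, (fiberEquiv p.proj).symm p.snd⟩ : Bundle.TotalSpace F₁ V₁))

/-- A smooth vector bundle with model fiber `F` is trivial if it is isomorphic to the product
bundle `M × F`. -/
def IsTrivialVectorBundle {B H M : Type*} [NormedAddCommGroup B] [NormedSpace ℝ B]
    [TopologicalSpace H] (I : ModelWithCorners ℝ B H) [TopologicalSpace M] [ChartedSpace H M]
    (F : Type*) [NormedAddCommGroup F] [NormedSpace ℝ F]
    (V : M → Type*) [TopologicalSpace (Bundle.TotalSpace F V)] [∀ x, TopologicalSpace (V x)]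
    [∀ x, AddCommGroup (V x)] [∀ x, Module ℝ (V x)] [FiberBundle F V] [VectorBundle ℝ F V] :
    Prop :=
  Nonempty (SmoothVectorBundleIso I F V F (Bundle.Trivial M F))

/-- A smooth `d`-manifold `M` is stably parallelizable if the direct sum of its tangent bundle and
the trivial line bundle is a trivial vector bundle. -/
def StablyParallelizable (d : ℕ) (M : Type*) [TopologicalSpace M]
    [ChartedSpace (EuclideanSpace ℝ (Fin d)) M] [IsManifold (𝓡 d) ∞ M] : Prop :=
  IsTrivialVectorBundle (𝓡 d) (EuclideanSpace ℝ (Fin d) × ℝ)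
    ((TangentSpace (𝓡 d) : M → Type _) ×ᵇ Bundle.Trivial M ℝ)

/-! ### Parseval frames -/

/-- A smooth Riemannian metric on a smooth `d`-manifold. -/
abbrev RiemannianMetricOn (d : ℕ) (M : Type*) [TopologicalSpace M]
    [ChartedSpace (EuclideanSpace ℝ (Fin d)) M] [IsManifold (𝓡 d) ∞ M] : Type _ :=
  Bundle.ContMDiffRiemannianMetric (𝓡 d) ∞ (EuclideanSpace ℝ (Fin d))
    (TangentSpace (𝓡 d) : M → Type _)

/-- A Parseval frame of size `n` on the tangent bundle of a Riemannian manifold: `n` smooth vector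
fields whose frame operator `v ↦ ∑ j, ⟪v, σ j⟫ σ j` is the identity of every tangent space
(in particular, they span every tangent space). -/
def IsParsevalFrame {d : ℕ} {M : Type*} [TopologicalSpace M]
    [ChartedSpace (EuclideanSpace ℝ (Fin d)) M] [IsManifold (𝓡 d) ∞ M]
    (g : RiemannianMetricOn d M) {n : ℕ} (σ : Fin n → ∀ x : M, TangentSpace (𝓡 d) x) : Prop :=
  (∀ j, ContMDiff (𝓡 d) (𝓡 d).tangent ∞ (fun x => (⟨x, σ j x⟩ : TangentBundle (𝓡 d) M))) ∧
    ∀ (x : M) (v : TangentSpace (𝓡 d) x), ∑ j, g.inner x v (σ j x) • σ j x = v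

/-- The tangent bundle of the Riemannian manifold `(M, g)` admits a Parseval frame of size `n`. -/
def AdmitsParsevalFrame {d : ℕ} {M : Type*} [TopologicalSpace M]
    [ChartedSpace (EuclideanSpace ℝ (Fin d)) M] [IsManifold (𝓡 d) ∞ M]
    (g : RiemannianMetricOn d M) (n : ℕ) : Prop :=
  ∃ σ : Fin n → ∀ x : M, TangentSpace (𝓡 d) x, IsParsevalFrame g σ

end

/-!
The two directions rest on the same picture: a Parseval frame of size `n` on `TM` is the orthogonal
projection to `TM` of an orthonormal frame of a trivial bundle of rank `n` containing `TM`
isometrically.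

If `TM ⊕ ℝ` is trivial, a global frame of it is orthonormalised, smoothly, for the sum of the given
metric and the standard metric of `ℝ`. Its Gram matrix is a smooth family of positive definite
matrices, and the Gram–Schmidt recursion shows that the inverse of its lower triangular factor is
smooth (`exists_contMDiff_mul_mul_transpose_eq_one`). The tangential parts of the orthonormal frame
form a Parseval frame (`parseval_of_mul_stabilizedGram_mul_transpose`).

Conversely, the analysis map `v ↦ (⟪v, σ j⟫)_j` of a Parseval frame of size `d + 1` is an isometric
embedding of `TM` in a trivial bundle, whose orthogonal complement is a line bundle, consisting of
the linear relations between the members of the frame. A smooth unit section `ν` of this line bundle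
gives the trivialisation `(v, t) ↦ (⟪v, σ j⟫)_j + t ν` of `TM ⊕ ℝ`, with inverse
`y ↦ (∑ j, y j σ j, ⟪ν, y⟫)`.

The section `ν` is found as follows. The line bundle is described by an arbitrary choice `w` of unit
generators such that the orthogonal projections to the lines vary smoothly. Over a simplex, which is
compact and contractible, the lines have a continuous unit generator (`exists_lineFieldLift`), unique
up to sign. Comparing it with `w` at the two ends of a path gives a singular `1`-cochain with values
in `ℤ/2`, which is a cocycle because lines over a `2`-simplex have a global generator. As
`H¹(M; ℤ/2) = 0`, it is the coboundary of a function `M → ℤ/2`, which tells where to change the sign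
of `w` so that the result is parallel along all paths (`exists_parallel_generator`). Since `M` is
locally path-connected, the resulting generator is continuous
(`exists_lineFieldLift_of_subsingleton_singularCohomology`), and then it is smooth, being locally the
normalised projection of a constant vector (`LineFieldLift.contMDiff`).
-/

/-! ### Line fields over simplices -/

section LineField

open InnerProductSpace Topology

variable {E : Type*} [NormedAddCommGroup E] [InnerProductSpace ℝ E]

/-- `LineFieldLift w u`: the vector field `u` is continuous and agrees with `w` up to a sign at each
point. The field `w`, which need not be continuous, stands for the field of lines that its values
generate; it is applied to fields of unit vectors, and the line field is continuous if the
orthogonal projection `rankOne ℝ (w x) (w x)` depends continuously on `x`. -/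
structure LineFieldLift {X : Type*} [TopologicalSpace X] (w u : X → E) : Prop where
  continuous : Continuous u
  eq_or_neg : ∀ x, u x = w x ∨ u x = -w x

/-- Orthogonal projections onto two lines at distance less than one: the lines are not
orthogonal. -/
lemma inner_ne_zero_of_norm_rankOne_sub_lt_one {v w : E} (hv : ‖v‖ = 1)
    (h : ‖rankOne ℝ w w - rankOne ℝ v v‖ < 1) : inner ℝ w v ≠ 0 := by
  intro h0
  have h1 : (rankOne ℝ w w - rankOne ℝ v v) v = -v := by
    simp [h0, hv]
  have h2 := (rankOne ℝ w w - rankOne ℝ v v).le_opNorm v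
  rw [h1, norm_neg, hv, mul_one] at h2
  linarith

/-- A unit vector field generating line fields can be transported to a uniformly close line field:
project, then normalise. -/
lemma LineFieldLift.exists_of_norm_rankOne_sub_lt_one {X : Type*} [TopologicalSpace X]
    {w w' u : X → E} (hw : ∀ x, ‖w x‖ = 1) (hw' : ∀ x, ‖w' x‖ = 1)
    (hc : Continuous fun x => rankOne ℝ (w' x) (w' x))
    (h : ∀ x, ‖rankOne ℝ (w' x) (w' x) - rankOne ℝ (w x) (w x)‖ < 1)
    (hu : LineFieldLift w u) : ∃ u', LineFieldLift w' u' := by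
  have hne : ∀ x, inner ℝ (w' x) (u x) ≠ 0 := fun x => by
    have := inner_ne_zero_of_norm_rankOne_sub_lt_one (hw x) (h x)
    rcases hu.eq_or_neg x with h | h <;> simp [h, this]
  have hnorm : ∀ x, ‖rankOne ℝ (w' x) (w' x) (u x)‖ = |inner ℝ (w' x) (u x)| := fun x => by
    simp [norm_smul, hw']
  refine ⟨fun x => ‖rankOne ℝ (w' x) (w' x) (u x)‖⁻¹ • rankOne ℝ (w' x) (w' x) (u x), ?_, ?_⟩
  · have h1 : Continuous fun x => rankOne ℝ (w' x) (w' x) (u x) := hc.clm_apply hu.continuous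
    refine (h1.norm.inv₀ fun x => ?_).smul h1
    rw [hnorm]
    exact abs_ne_zero.2 (hne x)
  · intro x
    rw [hnorm, rankOne_apply, smul_smul]
    rcases lt_or_gt_of_ne (hne x) with h | h
    · right
      rw [abs_of_neg h, inv_neg, neg_mul, inv_mul_cancel₀ h.ne, neg_one_smul]
    · left
      rw [abs_of_pos h, inv_mul_cancel₀ h.ne', one_smul]

lemma eventually_forall_dist_lt {T X Y : Type*} [TopologicalSpace T] [TopologicalSpace X]
    [CompactSpace X] [PseudoMetricSpace Y] {f : T × X → Y} (hf : Continuous f) {ε : ℝ} (hε : 0 < ε)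
    (s : T) : ∀ᶠ t in 𝓝 s, ∀ x, dist (f (t, x)) (f (s, x)) < ε := by
  let Q : C(T, C(X, Y)) := ContinuousMap.curry ⟨f, hf⟩
  filter_upwards [Metric.tendsto_nhds.1 (Q.continuous.tendsto s) ε hε] with t ht x
  exact (ContinuousMap.dist_apply_le_dist (f := Q t) (g := Q s) x).trans_lt ht

/-- A continuous line field on a compact contractible space is generated by a continuous field of
unit vectors: the set of times of a contraction at which the line field can be so generated is
open and closed. -/
lemma exists_lineFieldLift {X : Type*} [TopologicalSpace X] [CompactSpace X] [ContractibleSpace X]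
    (w : X → E) (hw : ∀ x, ‖w x‖ = 1) (hc : Continuous fun x => rankOne ℝ (w x) (w x)) :
    ∃ u, LineFieldLift w u := by
  obtain ⟨x₀, ⟨H⟩⟩ := id_nullhomotopic X
  have key : (∃ u, LineFieldLift (fun x => w (H (1, x))) u) →
      ∃ u, LineFieldLift (fun x => w (H (0, x))) u := by
    refine PreconnectedSpace.induction₂' (fun s t : unitInterval =>
      (∃ u, LineFieldLift (fun x => w (H (s, x))) u) →
        ∃ u, LineFieldLift (fun x => w (H (t, x))) u) (fun s => ?_) ⟨fun _ _ _ h h' => h' ∘ h⟩ 1 0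
    have step : ∀ s t : unitInterval,
        (∀ x, dist (rankOne ℝ (w (H (t, x))) (w (H (t, x))))
          (rankOne ℝ (w (H (s, x))) (w (H (s, x)))) < 1) →
        (∃ u, LineFieldLift (fun x => w (H (s, x))) u) →
          ∃ u, LineFieldLift (fun x => w (H (t, x))) u := by
      rintro s t hst ⟨u, hu⟩
      refine LineFieldLift.exists_of_norm_rankOne_sub_lt_one (fun x => hw _) (fun x => hw _)
        (hc.comp (H.continuous.comp (by fun_prop))) (fun x => ?_) hu
      simpa only [dist_eq_norm] using hst x
    filter_upwards [eventually_forall_dist_lt (hc.comp H.continuous) one_pos s] with t ht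
    exact ⟨step s t ht, step t s fun x => by rw [dist_comm]; exact ht x⟩
  obtain ⟨u, hu⟩ := key ⟨fun _ => w x₀, continuous_const, fun x => Or.inl (by simp)⟩
  exact ⟨u, hu.continuous, fun x => by simpa using hu.eq_or_neg x⟩

lemma pos_iff_pos_of_continuous_of_ne_zero {X : Type*} [TopologicalSpace X] [PreconnectedSpace X]
    {f : X → ℝ} (hf : Continuous f) (h0 : ∀ x, f x ≠ 0) (x y : X) : 0 < f x ↔ 0 < f y := by
  suffices h : ∀ x y, 0 < f x → 0 < f y from ⟨h x y, h y x⟩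
  intro x y hx
  by_contra hy
  obtain ⟨z, hz⟩ := mem_range_of_exists_le_of_exists_ge hf ⟨y, not_lt.1 hy⟩ ⟨x, hx.le⟩
  exact h0 z hz

lemma LineFieldLift.norm_eq_one {F X : Type*} [NormedAddCommGroup F] [TopologicalSpace X]
    {w u : X → F} (hw : ∀ x, ‖w x‖ = 1) (hu : LineFieldLift w u) (x : X) : ‖u x‖ = 1 := by
  rcases hu.eq_or_neg x with h | h <;> simp [h, hw]

lemma LineFieldLift.comp {F X Y : Type*} [NormedAddCommGroup F] [TopologicalSpace X]
    [TopologicalSpace Y] {w u : X → F} (hu : LineFieldLift w u) (f : C(Y, X)) :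
    LineFieldLift (w ∘ f) (u ∘ f) :=
  ⟨hu.continuous.comp f.continuous, fun x => hu.eq_or_neg (f x)⟩

/-- On a connected space, two continuous unit generators of a line field agree up to a global
sign. -/
lemma LineFieldLift.eq_or_eq_neg {X : Type*} [TopologicalSpace X] [PreconnectedSpace X]
    {w u v : X → E} (hw : ∀ x, ‖w x‖ = 1) (hu : LineFieldLift w u) (hv : LineFieldLift w v) :
    u = v ∨ u = -v := by
  have hx : ∀ x, (u x = v x ∨ u x = -v x) := fun x => by
    rcases hu.eq_or_neg x with h | h <;> rcases hv.eq_or_neg x with h' | h' <;> simp [h, h']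
  have hv1 := hv.norm_eq_one hw
  have h0 : ∀ x, inner ℝ (u x) (v x) ≠ 0 := fun x => by
    rcases hx x with h | h <;> simp [h, hv1]
  have hpos := pos_iff_pos_of_continuous_of_ne_zero (hu.continuous.inner hv.continuous) h0
  by_cases h : ∀ x, 0 < inner ℝ (u x) (v x)
  · left
    funext x
    refine (hx x).resolve_right fun h' => ?_
    have := h x
    simp only [h', inner_neg_left, real_inner_self_eq_norm_sq, hv1] at this
    norm_num at this
  · right
    push Not at h
    obtain ⟨y, hy⟩ := h
    funext x
    refine (hx x).resolve_left fun h' => ?_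
    have := (hpos x y).not.2 hy.not_gt
    simp only [h', real_inner_self_eq_norm_sq, hv1] at this
    norm_num at this

end LineField

/-! ### The obstruction cocycle of a line field -/

section Cocycle

open InnerProductSpace Topology

variable {E : Type*} [NormedAddCommGroup E] [InnerProductSpace ℝ E]

/-- The sign of a nonzero real number, written additively: `0` for positive numbers and `1` for
negative ones. -/
noncomputable def signBit (r : ℝ) : ZMod 2 := if 0 < r then 0 else 1

lemma signBit_neg {r : ℝ} (hr : r ≠ 0) : signBit (-r) = signBit r + 1 := by
  unfold signBit
  rcases lt_or_gt_of_ne hr with h | h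
  · rw [if_pos (by linarith), if_neg (by linarith)]; decide
  · rw [if_neg (by linarith), if_pos h]; decide

instance (n : ℕ) : ContractibleSpace (stdSimplex ℝ (Fin (n + 1))) :=
  (convex_stdSimplex ℝ _).contractibleSpace ⟨_, single_mem_stdSimplex ℝ 0⟩

lemma singularCoboundary_zero_apply {R M : Type*} [CommRing R] [TopologicalSpace M]
    (ψ : SingularCochain R M 0) (σ : SingularSimplex 1 M) :
    singularCoboundary R M 0 ψ σ =
      ψ (σ.comp (stdSimplexFace 0 0)) - ψ (σ.comp (stdSimplexFace 0 1)) := by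
  change ∑ i : Fin 2, (-1 : R) ^ (i : ℕ) * ψ (σ.comp (stdSimplexFace 0 i)) = _
  rw [Fin.sum_univ_two]
  simp [sub_eq_add_neg]

lemma singularCoboundary_one_apply {R M : Type*} [CommRing R] [TopologicalSpace M]
    (φ : SingularCochain R M 1) (τ : SingularSimplex 2 M) :
    singularCoboundary R M 1 φ τ = φ (τ.comp (stdSimplexFace 1 0)) -
      φ (τ.comp (stdSimplexFace 1 1)) + φ (τ.comp (stdSimplexFace 1 2)) := by
  change ∑ i : Fin 3, (-1 : R) ^ (i : ℕ) * φ (τ.comp (stdSimplexFace 1 i)) = _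
  rw [Fin.sum_univ_three]
  simp [sub_eq_add_neg]

/-- The signs of a continuous generator `u` of a line field along a singular simplex relative to
the reference generator `w` at the vertices. -/
noncomputable def vertexSign {M : Type*} [TopologicalSpace M] (w : M → E) {n : ℕ}
    (σ : SingularSimplex n M) (u : stdSimplex ℝ (Fin (n + 1)) → E) (i : Fin (n + 1)) : ZMod 2 :=
  signBit (inner ℝ (u (stdSimplex.vertex i)) (w (σ (stdSimplex.vertex i))))

lemma vertexSign_comp_face {M : Type*} [TopologicalSpace M] (w : M → E) {n : ℕ}
    (σ : SingularSimplex (n + 1) M) (u : stdSimplex ℝ (Fin (n + 2)) → E) (i : Fin (n + 2))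
    (j : Fin (n + 1)) :
    vertexSign w (σ.comp (stdSimplexFace n i)) (u ∘ stdSimplexFace n i) j =
      vertexSign w σ u (i.succAbove j) := by
  have : stdSimplexFace n i (stdSimplex.vertex j) = stdSimplex.vertex (i.succAbove j) :=
    stdSimplex.map_vertex _ _
  simp [vertexSign, this]

variable {M : Type*} [TopologicalSpace M] {w : M → E}

lemma inner_ne_zero_of_lineFieldLift (hw : ∀ x, ‖w x‖ = 1) {n : ℕ} {σ : SingularSimplex n M}
    {u : stdSimplex ℝ (Fin (n + 1)) → E} (hu : LineFieldLift (w ∘ σ) u) (t) :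
    inner ℝ (u t) (w (σ t)) ≠ 0 := by
  rcases hu.eq_or_neg t with h | h <;> simp [h, hw]

/-- The sum of the signs of a generator at the two ends of a path does not depend on the generator:
it is the monodromy of the line field along the path, relative to `w`. -/
lemma vertexSign_add_eq (hw : ∀ x, ‖w x‖ = 1) {σ : SingularSimplex 1 M}
    {u v : stdSimplex ℝ (Fin 2) → E} (hu : LineFieldLift (w ∘ σ) u)
    (hv : LineFieldLift (w ∘ σ) v) :
    vertexSign w σ u 0 + vertexSign w σ u 1 = vertexSign w σ v 0 + vertexSign w σ v 1 := by
  rcases hu.eq_or_eq_neg (fun x => hw (σ x)) hv with rfl | rfl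
  · rfl
  · simp only [vertexSign, Pi.neg_apply, inner_neg_left]
    rw [signBit_neg (inner_ne_zero_of_lineFieldLift hw hv _),
      signBit_neg (inner_ne_zero_of_lineFieldLift hw hv _)]
    generalize signBit _ = a
    generalize signBit _ = b
    revert a b
    decide

/-- If `H¹(M; ℤ/2) = 0`, the signs of the generators of a continuous line field can be chosen
compatibly along all paths: the monodromy relative to an arbitrary choice of generators is a
cocycle, and a primitive of it tells which generators to replace by their opposites. -/
lemma exists_parallel_generator (hw : ∀ x, ‖w x‖ = 1)
    (hc : Continuous fun x => rankOne ℝ (w x) (w x))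
    (hM : Subsingleton (SingularCohomology (ZMod 2) M 1)) :
    ∃ ν : M → E, (∀ x, ν x = w x ∨ ν x = -w x) ∧
      ∀ (σ : SingularSimplex 1 M) (u : stdSimplex ℝ (Fin 2) → E), LineFieldLift (w ∘ σ) u →
        vertexSign ν σ u 0 = vertexSign ν σ u 1 := by
  have hlift : ∀ {n : ℕ} (σ : SingularSimplex n M), ∃ u, LineFieldLift (w ∘ σ) u := fun σ =>
    exists_lineFieldLift _ (fun x => hw _) (hc.comp σ.continuous)
  choose u hu using fun σ : SingularSimplex 1 M => hlift σ
  let φ : SingularCochain (ZMod 2) M 1 := fun σ => vertexSign w σ (u σ) 0 + vertexSign w σ (u σ) 1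
  have hφ : φ ∈ singularCocycles (ZMod 2) M 1 := by
    refine LinearMap.mem_ker.2 (funext fun τ => ?_)
    -- The sum over the faces of `τ` can be computed with the restrictions of one generator over
    -- `τ`, and then contains the sign at each vertex twice.
    obtain ⟨v, hv⟩ := hlift τ
    have hface : ∀ i, φ (τ.comp (stdSimplexFace 1 i)) =
        vertexSign w τ v (i.succAbove 0) + vertexSign w τ v (i.succAbove 1) := fun i => by
      rw [← vertexSign_comp_face, ← vertexSign_comp_face]
      exact vertexSign_add_eq hw (hu _) (hv.comp (stdSimplexFace 1 i))
    have e0 : (0 : Fin 3).succAbove (0 : Fin 2) = 1 := by decide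
    have e1 : (0 : Fin 3).succAbove (1 : Fin 2) = 2 := by decide
    have e2 : (1 : Fin 3).succAbove (0 : Fin 2) = 0 := by decide
    have e3 : (1 : Fin 3).succAbove (1 : Fin 2) = 2 := by decide
    have e4 : (2 : Fin 3).succAbove (0 : Fin 2) = 0 := by decide
    have e5 : (2 : Fin 3).succAbove (1 : Fin 2) = 1 := by decide
    rw [singularCoboundary_one_apply, hface, hface, hface, e0, e1, e2, e3, e4, e5, Pi.zero_apply]
    have hcancel : ∀ a b c : ZMod 2, b + c - (a + c) + (a + b) = 0 := by decide
    exact hcancel _ _ _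
  have hmem : φ ∈ singularCoboundaries (ZMod 2) M 1 := by
    have := (Submodule.Quotient.mk_eq_zero _).1 (hM.elim
      (Submodule.Quotient.mk (p := (singularCoboundaries (ZMod 2) M 1).comap
        (singularCocycles (ZMod 2) M 1).subtype) ⟨φ, hφ⟩) 0)
    exact this
  obtain ⟨ψ, hψ⟩ := hmem
  let n : M → ZMod 2 := fun x => ψ (ContinuousMap.const _ x)
  have hn : ∀ σ, φ σ = n (σ (stdSimplex.vertex 0)) + n (σ (stdSimplex.vertex 1)) := fun σ => by
    have hface : ∀ i : Fin 2, σ.comp (stdSimplexFace 0 i) =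
        ContinuousMap.const _ (σ (stdSimplex.vertex (i.succAbove 0))) := fun i => by
      ext t
      have ht : t = stdSimplex.vertex 0 := Subsingleton.elim _ _
      have : stdSimplexFace 0 i t = stdSimplex.vertex (i.succAbove 0) := by
        rw [ht]
        exact stdSimplex.map_vertex _ _
      simp [this]
    have e0 : (0 : Fin 2).succAbove (0 : Fin 1) = 1 := by decide
    have e1 : (1 : Fin 2).succAbove (0 : Fin 1) = 0 := by decide
    rw [← hψ, singularCoboundary_zero_apply, hface, hface, e0, e1]
    change n _ - n _ = n _ + n _
    generalize n (σ _) = a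
    generalize n (σ _) = b
    revert a b
    decide
  refine ⟨fun x => if n x = 0 then w x else -w x, fun x => ?_, fun σ v hv => ?_⟩
  · dsimp only
    split_ifs <;> simp
  · have hsign : ∀ i, vertexSign (fun x => if n x = 0 then w x else -w x) σ v i =
        vertexSign w σ v i + n (σ (stdSimplex.vertex i)) := fun i => by
      unfold vertexSign
      have h01 : ∀ a : ZMod 2, a = 0 ∨ a = 1 := by decide
      rcases h01 (n (σ (stdSimplex.vertex i))) with h | h
      · simp [h]
      · simp [h, signBit_neg (inner_ne_zero_of_lineFieldLift hw hv _)]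
    have h1 := hn σ
    rw [show φ σ = vertexSign w σ v 0 + vertexSign w σ v 1 from
      vertexSign_add_eq hw (hu σ) hv] at h1
    rw [hsign, hsign]
    revert h1
    generalize n (σ _) = a
    generalize n (σ _) = b
    generalize vertexSign w σ v 0 = c
    generalize vertexSign w σ v 1 = d
    revert a b c d
    decide

/-- A continuous line field over a locally path-connected space `M` with `H¹(M; ℤ/2) = 0` is
generated by a continuous field of unit vectors. -/
theorem exists_lineFieldLift_of_subsingleton_singularCohomology [LocallyPathConnectedSpace M]
    (hw : ∀ x, ‖w x‖ = 1) (hc : Continuous fun x => rankOne ℝ (w x) (w x))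
    (hM : Subsingleton (SingularCohomology (ZMod 2) M 1)) : ∃ ν, LineFieldLift w ν := by
  obtain ⟨ν, hν, hpar⟩ := exists_parallel_generator hw hc hM
  have hν1 : ∀ x, ‖ν x‖ = 1 := fun x => by rcases hν x with h | h <;> simp [h, hw]
  have hrank : ∀ x, rankOne ℝ (w x) (w x) = rankOne ℝ (ν x) (ν x) := fun x => by
    ext y
    rcases hν x with h | h <;> simp only [rankOne_apply, h, inner_neg_left, neg_smul_neg]
  refine ⟨ν, continuous_iff_continuousAt.2 fun x₀ => ?_, hν⟩
  -- Near `x₀`, the field `ν` is the normalised projection of `ν x₀` to the lines.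
  let f : M → E := fun x => rankOne ℝ (w x) (w x) (ν x₀)
  have hf : Continuous f := hc.clm_apply continuous_const
  have hfν : ∀ x, f x = inner ℝ (ν x) (ν x₀) • ν x := fun x => by
    simp only [f, hrank, rankOne_apply]
  have hpos : ∀ᶠ x in 𝓝 x₀, 0 < inner ℝ (ν x) (ν x₀) := by
    have hU : {x | f x ≠ 0} ∈ 𝓝 x₀ :=
      hf.continuousAt.eventually_ne (by rw [hfν]; simp [hν1, ← norm_ne_zero_iff])
    obtain ⟨V, ⟨hVx, hVpath⟩, hVU⟩ := (path_connected_basis x₀).mem_iff.1 hU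
    filter_upwards [hVx] with x hx
    obtain ⟨γ, hγ⟩ := hVpath.joinedIn x₀ (mem_of_mem_nhds hVx) x hx
    let σ : SingularSimplex 1 M :=
      γ.toContinuousMap.comp ⟨stdSimplexHomeomorphUnitInterval,
        stdSimplexHomeomorphUnitInterval.continuous⟩
    have hσ0 : σ (stdSimplex.vertex 0) = x₀ := by
      have : stdSimplexHomeomorphUnitInterval (stdSimplex.vertex 0) = 0 :=
        stdSimplexHomeomorphUnitInterval_zero
      simp [σ, this]
    have hσ1 : σ (stdSimplex.vertex 1) = x := by
      have : stdSimplexHomeomorphUnitInterval (stdSimplex.vertex 1) = 1 :=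
        stdSimplexHomeomorphUnitInterval_one
      simp [σ, this]
    obtain ⟨u, hu⟩ := exists_lineFieldLift (w ∘ σ) (fun t => hw _) (hc.comp σ.continuous)
    have huν : ∀ t, u t = ν (σ t) ∨ u t = -ν (σ t) := fun t => by
      have := hu.eq_or_neg t
      rcases hν (σ t) with h | h <;> simp_all [or_comm]
    -- Along the path, the generator `u` is never orthogonal to `ν x₀`, so the sign of its product
    -- with `ν x₀` is the same at both ends.
    have hne : ∀ t, inner ℝ (u t) (ν x₀) ≠ 0 := fun t => by
      have h1 : f (σ t) ≠ 0 := hVU (hγ _)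
      rw [hfν] at h1
      have h2 := left_ne_zero_of_smul h1
      rcases huν t with h | h <;> simp [h, h2]
    have hs := pos_iff_pos_of_continuous_of_ne_zero (hu.continuous.inner continuous_const) hne
      (stdSimplex.vertex 0) (stdSimplex.vertex 1)
    have hp := hpar σ u hu
    have hn0 := hne (stdSimplex.vertex 1)
    simp only [vertexSign, hσ0, hσ1, signBit] at hp
    have h0 := huν (stdSimplex.vertex 0)
    have h1 := huν (stdSimplex.vertex 1)
    rw [hσ0] at h0
    rw [hσ1] at h1
    rcases h0 with h0 | h0 <;> rcases h1 with h1 | h1 <;>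
      simp [h0, h1, hν1] at hs hp hn0 ⊢
    · exact hs
    · refine lt_of_le_of_ne (not_lt.1 fun h => ?_) (Ne.symm hn0)
      exact absurd (hs.2 h) (by norm_num)
  have hcont : ContinuousAt (fun x => ‖f x‖⁻¹ • f x) x₀ := by
    refine (hf.norm.continuousAt.inv₀ ?_).smul hf.continuousAt
    rw [hfν]
    simp [hν1]
  refine hcont.congr ?_
  filter_upwards [hpos] with x hx
  rw [hfν, norm_smul, hν1, mul_one, Real.norm_of_nonneg hx.le, smul_smul, inv_mul_cancel₀ hx.ne',
    one_smul]

end Cocycle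

/-! ### Smooth maps into sums of vector bundles -/

section Bundles

open Bundle Topology

variable {EB : Type*} [NormedAddCommGroup EB] [NormedSpace ℝ EB] {HB : Type*} [TopologicalSpace HB]
  {IB : ModelWithCorners ℝ EB HB} {B : Type*} [TopologicalSpace B] [ChartedSpace HB B]
  {EN : Type*} [NormedAddCommGroup EN] [NormedSpace ℝ EN] {HN : Type*} [TopologicalSpace HN]
  {IN : ModelWithCorners ℝ EN HN} {N : Type*} [TopologicalSpace N] [ChartedSpace HN N]
  {n : ℕ∞ω}
  {F₁ : Type*} [NormedAddCommGroup F₁] [NormedSpace ℝ F₁] {V₁ : B → Type*}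
  [TopologicalSpace (TotalSpace F₁ V₁)] [∀ x, AddCommGroup (V₁ x)] [∀ x, TopologicalSpace (V₁ x)]
  [FiberBundle F₁ V₁]
  {F₂ : Type*} [NormedAddCommGroup F₂] [NormedSpace ℝ F₂] {V₂ : B → Type*}
  [TopologicalSpace (TotalSpace F₂ V₂)] [∀ x, AddCommGroup (V₂ x)] [∀ x, TopologicalSpace (V₂ x)]
  [FiberBundle F₂ V₂]

/-- A map into a direct sum of vector bundles is smooth if and only if both components are. -/
lemma contMDiff_prodBundle_iff (f : N → TotalSpace (F₁ × F₂) (V₁ ×ᵇ V₂)) :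
    ContMDiff IN (IB.prod 𝓘(ℝ, F₁ × F₂)) n f ↔
      ContMDiff IN (IB.prod 𝓘(ℝ, F₁)) n (fun m => (⟨(f m).proj, (f m).2.1⟩ : TotalSpace F₁ V₁)) ∧
      ContMDiff IN (IB.prod 𝓘(ℝ, F₂)) n
        (fun m => (⟨(f m).proj, (f m).2.2⟩ : TotalSpace F₂ V₂)) := by
  unfold ContMDiff
  rw [← forall_and]
  refine forall_congr' fun m => ?_
  simp only [contMDiffAt_totalSpace]
  rw [contMDiffAt_prod_module_iff, ← and_and_left]
  rfl

/-- A map into a trivial bundle is smooth if and only if its base point and its vector part are. -/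
lemma contMDiff_trivialBundle_iff (f : N → TotalSpace F₁ (Bundle.Trivial B F₁)) :
    ContMDiff IN (IB.prod 𝓘(ℝ, F₁)) n f ↔
      ContMDiff IN IB n (fun m => (f m).proj) ∧ ContMDiff IN 𝓘(ℝ, F₁) n (fun m => (f m).2) := by
  unfold ContMDiff
  rw [← forall_and]
  refine forall_congr' fun m => ?_
  simp only [contMDiffAt_totalSpace]
  rfl

/-- Linear combinations, with smooth coefficients, of smooth maps into a vector bundle over the
same map to the base are smooth. -/
lemma contMDiff_sum_smul_bundle [∀ x, Module ℝ (V₁ x)] [VectorBundle ℝ F₁ V₁]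
    {ι : Type*} (s : Finset ι) {b : N → B}
    (hb : ContMDiff IN IB n b) {c : ι → N → ℝ} {v : ι → ∀ m, V₁ (b m)}
    (hc : ∀ i ∈ s, ContMDiff IN 𝓘(ℝ, ℝ) n (c i))
    (hv : ∀ i ∈ s, ContMDiff IN (IB.prod 𝓘(ℝ, F₁)) n
      (fun m => (⟨b m, v i m⟩ : TotalSpace F₁ V₁))) :
    ContMDiff IN (IB.prod 𝓘(ℝ, F₁)) n
      (fun m => (⟨b m, ∑ i ∈ s, c i m • v i m⟩ : TotalSpace F₁ V₁)) := by
  intro m₀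
  refine contMDiffAt_totalSpace.2 ⟨hb m₀, ?_⟩
  let e := trivializationAt F₁ V₁ (b m₀)
  have hsum : ContMDiffAt IN 𝓘(ℝ, F₁) n (fun m => ∑ i ∈ s, c i m • (e ⟨b m, v i m⟩).2) m₀ :=
    contMDiffAt_finsetSum fun i hi =>
      (hc i hi m₀).smul (contMDiffAt_totalSpace.1 (hv i hi m₀)).2
  refine hsum.congr_of_eventuallyEq ?_
  filter_upwards [hb.continuous.continuousAt.preimage_mem_nhds
    (e.open_baseSet.mem_nhds (mem_baseSet_trivializationAt F₁ V₁ (b m₀)))] with m hm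
  have hlin := e.linear ℝ hm
  change (hlin.mk' _) _ = ∑ i ∈ s, c i m • (hlin.mk' _) (v i m)
  simp

end Bundles

/-! ### Smooth orthonormalisation -/

section Orthonormalisation

open Matrix InnerProductSpace

variable {EB : Type*} [NormedAddCommGroup EB] [NormedSpace ℝ EB] {HB : Type*} [TopologicalSpace HB]
  {IB : ModelWithCorners ℝ EB HB} {B : Type*} [TopologicalSpace B] [ChartedSpace HB B]
  {r : ℕ∞ω} {ι : Type*}

lemma contMDiff_dotProduct_mulVec [Fintype ι] {G : B → Matrix ι ι ℝ} {u v : B → ι → ℝ}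
    (hG : ∀ i j, ContMDiff IB 𝓘(ℝ, ℝ) r (fun x => G x i j))
    (hu : ∀ i, ContMDiff IB 𝓘(ℝ, ℝ) r (fun x => u x i))
    (hv : ∀ i, ContMDiff IB 𝓘(ℝ, ℝ) r (fun x => v x i)) :
    ContMDiff IB 𝓘(ℝ, ℝ) r (fun x => u x ⬝ᵥ (G x *ᵥ v x)) :=
  contMDiff_finsetSum fun i _ => (hu i).mul (contMDiff_finsetSum fun j _ => (hG i j).mul (hv j))

variable [LinearOrder ι] [WellFoundedLT ι] [LocallyFiniteOrderBot ι]

lemma gramSchmidt_eq_sub_sum_inner_div {E : Type*} [NormedAddCommGroup E] [InnerProductSpace ℝ E]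
    (f : ι → E) (i : ι) : gramSchmidt ℝ f i = f i - ∑ k ∈ Finset.Iio i,
      (inner ℝ (gramSchmidt ℝ f k) (f i) / inner ℝ (gramSchmidt ℝ f k) (gramSchmidt ℝ f k)) •
        gramSchmidt ℝ f k := by
  simp only [real_inner_self_eq_norm_sq]
  exact eq_sub_of_add_eq (gramSchmidt_def'' ℝ f i).symm

variable [Fintype ι]

/-- The recursion of the Gram–Schmidt process for the inner product defined by a matrix. -/
lemma LDL.lowerInv_apply {S : Matrix ι ι ℝ} (hS : S.PosDef) (i j : ι) :
    LDL.lowerInv hS i j = Pi.basisFun ℝ ι i j - ∑ k ∈ Finset.Iio i,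
      (LDL.lowerInv hS k ⬝ᵥ (S *ᵥ Pi.basisFun ℝ ι i)) /
        (LDL.lowerInv hS k ⬝ᵥ (S *ᵥ LDL.lowerInv hS k)) * LDL.lowerInv hS k j := by
  have hdot : ∀ u v : ι → ℝ, u ⬝ᵥ (S *ᵥ v) = (Sᵀ *ᵥ v) ⬝ᵥ u := fun u v => by
    rw [show Sᵀ = S from hS.isHermitian.eq, dotProduct_comm]
  have h := congrFun (@gramSchmidt_eq_sub_sum_inner_div ι _ _ _ (ι → ℝ)
    (Sᵀ.toNormedAddCommGroup hS.transpose) (Sᵀ.toInnerProductSpace hS.transpose.posSemidef)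
    (Pi.basisFun ℝ ι) i) j
  rw [Pi.sub_apply, Finset.sum_apply] at h
  refine h.trans (congrArg₂ _ rfl (Finset.sum_congr rfl fun k _ => ?_))
  rw [hdot, hdot]
  rfl

lemma LDL.lowerInv_dotProduct_pos {S : Matrix ι ι ℝ} (hS : S.PosDef) (i : ι) :
    0 < LDL.lowerInv hS i ⬝ᵥ (S *ᵥ LDL.lowerInv hS i) := by
  refine hS.dotProduct_mulVec_pos fun (h : LDL.lowerInv hS i = 0) => ?_
  have h1 := congrFun (congrFun (mul_invOf_self (LDL.lowerInv hS)) i) i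
  rw [Matrix.mul_apply_eq_vecMul, h, Matrix.zero_vecMul] at h1
  simp at h1

lemma contMDiff_lowerInv {G : B → Matrix ι ι ℝ}
    (hG : ∀ i j, ContMDiff IB 𝓘(ℝ, ℝ) r (fun x => G x i j)) (hpos : ∀ x, (G x).PosDef) (i : ι) :
    ∀ j, ContMDiff IB 𝓘(ℝ, ℝ) r (fun x => LDL.lowerInv (hpos x) i j) := by
  induction i using WellFoundedLT.induction with
  | ind i ih =>
  intro j
  simp only [fun x => LDL.lowerInv_apply (hpos x) i j]
  refine contMDiff_const.sub (contMDiff_finsetSum fun k hk => ?_)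
  have ihk := ih k (Finset.mem_Iio.1 hk)
  refine ContMDiff.mul (ContMDiff.div₀ (contMDiff_dotProduct_mulVec hG ihk (fun a => contMDiff_const))
    (contMDiff_dotProduct_mulVec hG ihk ihk) fun x => ?_) (ihk j)
  exact (LDL.lowerInv_dotProduct_pos (hpos x) k).ne'

/-- A smooth family of positive definite matrices is smoothly congruent to the identity
matrix. -/
lemma exists_contMDiff_mul_mul_transpose_eq_one {G : B → Matrix ι ι ℝ}
    (hG : ∀ i j, ContMDiff IB 𝓘(ℝ, ℝ) r (fun x => G x i j)) (hpos : ∀ x, (G x).PosDef) :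
    ∃ A : B → Matrix ι ι ℝ, (∀ i j, ContMDiff IB 𝓘(ℝ, ℝ) r (fun x => A x i j)) ∧
      ∀ x, A x * G x * (A x)ᵀ = 1 := by
  let L := fun x => LDL.lowerInv (hpos x)
  let D : B → ι → ℝ := fun x i => L x i ⬝ᵥ (G x *ᵥ L x i)
  have hD0 : ∀ x i, 0 < D x i := fun x i => LDL.lowerInv_dotProduct_pos (hpos x) i
  have hD : ∀ x, L x * G x * (L x)ᵀ = diagonal (D x) := fun x => by
    refine (LDL.diag_eq_lowerInv_conj (hpos x)).symm.trans (congrArg diagonal (funext fun i => ?_))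
    rw [LDL.diagEntries, EuclideanSpace.inner_toLp_toLp, star_star, dotProduct_comm, star_trivial]
  have hL := contMDiff_lowerInv hG hpos
  refine ⟨fun x => diagonal (fun i => (Real.sqrt (D x i))⁻¹) * L x, fun i j => ?_, fun x => ?_⟩
  · simp only [diagonal_mul]
    refine ContMDiff.mul ?_ (hL i j)
    have hDi : ContMDiff IB 𝓘(ℝ, ℝ) r (fun x => D x i) :=
      contMDiff_dotProduct_mulVec hG (hL i) (hL i)
    refine ContMDiff.inv₀ (fun x => ?_) fun x => (Real.sqrt_pos.2 (hD0 x i)).ne'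
    exact (contDiffAt_id.sqrt (hD0 x i).ne').contMDiffAt.comp (g := Real.sqrt) x (hDi x)
  · rw [transpose_mul, diagonal_transpose]
    calc _ = diagonal (fun i => (Real.sqrt (D x i))⁻¹) * (L x * G x * (L x)ᵀ) *
          diagonal (fun i => (Real.sqrt (D x i))⁻¹) := by simp only [Matrix.mul_assoc]
      _ = 1 := by
        rw [hD, diagonal_mul_diagonal, diagonal_mul_diagonal, ← diagonal_one]
        congr 1
        funext i
        have := Real.mul_self_sqrt (hD0 x i).le
        have h0 := (Real.sqrt_pos.2 (hD0 x i)).ne'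
        field_simp
        nlinarith

end Orthonormalisation

/-! ### Trivialisations of vector bundles -/

section Trivialisations

open Bundle

variable {EB : Type*} [NormedAddCommGroup EB] [NormedSpace ℝ EB] {HB : Type*} [TopologicalSpace HB]
  {I : ModelWithCorners ℝ EB HB} {B : Type*} [TopologicalSpace B] [ChartedSpace HB B]
  {F : Type*} [NormedAddCommGroup F] [NormedSpace ℝ F] {V : B → Type*}
  [TopologicalSpace (TotalSpace F V)] [∀ x, AddCommGroup (V x)] [∀ x, TopologicalSpace (V x)]
  [∀ x, Module ℝ (V x)] [FiberBundle F V] [VectorBundle ℝ F V]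

lemma IsTrivialVectorBundle.exists_linearEquiv (hV : IsTrivialVectorBundle I F V) :
    ∃ e : ∀ x, V x ≃ₗ[ℝ] F, ∀ c, ContMDiff I (I.prod 𝓘(ℝ, F)) ∞
      (fun x => (⟨x, (e x).symm c⟩ : TotalSpace F V)) := by
  obtain ⟨e⟩ := hV
  refine ⟨e.fiberEquiv, fun c => ?_⟩
  have h : ContMDiff I (I.prod 𝓘(ℝ, F)) ∞
      (fun x => (⟨x, c⟩ : TotalSpace F (Bundle.Trivial B F))) :=
    (contMDiff_trivialBundle_iff _).2 ⟨contMDiff_id, contMDiff_const⟩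
  exact e.contMDiff_invFun.comp h

lemma isTrivialVectorBundle_of_linearEquiv (e : ∀ x, V x ≃ₗ[ℝ] F)
    (h : ContMDiff (I.prod 𝓘(ℝ, F)) 𝓘(ℝ, F) ∞ (fun p : TotalSpace F V => e p.proj p.2))
    (h' : ContMDiff (I.prod 𝓘(ℝ, F)) (I.prod 𝓘(ℝ, F)) ∞
      (fun q : B × F => (⟨q.1, (e q.1).symm q.2⟩ : TotalSpace F V))) :
    IsTrivialVectorBundle I F V := by
  refine ⟨⟨e, (contMDiff_trivialBundle_iff _).2 ⟨contMDiff_proj V, h⟩, ?_⟩⟩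
  have hq : ContMDiff (I.prod 𝓘(ℝ, F)) (I.prod 𝓘(ℝ, F)) ∞
      (fun p : TotalSpace F (Bundle.Trivial B F) => ((p.proj, p.2) : B × F)) :=
    have := (contMDiff_trivialBundle_iff (n := ∞) (id : TotalSpace F (Bundle.Trivial B F) → _)).1
      contMDiff_id
    this.1.prodMk this.2
  exact h'.comp hq

end Trivialisations

/-! ### Linear algebra of Parseval frames -/

section LinearAlgebra

open InnerProductSpace Matrix Module

variable {V : Type*} [AddCommGroup V] [Module ℝ V] (β : V →ₗ[ℝ] V →ₗ[ℝ] ℝ)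

section StabilizedGram

variable {ι : Type*}

/-- The Gram matrix of a family of vectors of `V × ℝ` for the direct sum of the bilinear form `β`
and the standard form of `ℝ`. -/
def stabilizedGram (s : ι → V × ℝ) : Matrix ι ι ℝ :=
  Matrix.of fun i j => β (s i).1 (s j).1 + (s i).2 * (s j).2

variable [Fintype ι]

lemma stabilizedGram_mulVec (hβ : ∀ v w, β v w = β w v) (s : ι → V × ℝ) (c : ι → ℝ) (i : ι) :
    (stabilizedGram β s *ᵥ c) i =
      β (∑ j, c j • s j).1 (s i).1 + (∑ j, c j • s j).2 * (s i).2 := by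
  simp only [stabilizedGram, mulVec, dotProduct, of_apply, Prod.fst_sum, Prod.snd_sum, map_sum,
    LinearMap.sum_apply, Prod.smul_fst, Prod.smul_snd, map_smul, LinearMap.smul_apply, smul_eq_mul,
    Finset.sum_mul, ← Finset.sum_add_distrib]
  refine Finset.sum_congr rfl fun j _ => ?_
  rw [hβ]
  ring

lemma posDef_stabilizedGram (hβ : ∀ v w, β v w = β w v) (hpos : ∀ v ≠ 0, 0 < β v v)
    {s : ι → V × ℝ} (hs : LinearIndependent ℝ s) : (stabilizedGram β s).PosDef := by
  refine PosDef.of_dotProduct_mulVec_pos ?_ fun c hc => ?_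
  · ext i j
    simp [stabilizedGram, hβ (s i).1, mul_comm (s i).2]
  · have heq : star c ⬝ᵥ (stabilizedGram β s *ᵥ c) = β (∑ j, c j • s j).1 (∑ j, c j • s j).1 +
        (∑ j, c j • s j).2 * (∑ j, c j • s j).2 := by
      simp only [dotProduct, stabilizedGram_mulVec β hβ, Pi.star_apply, star_trivial]
      generalize hv : ∑ j, c j • s j = v
      have h1 : β v.1 v.1 = ∑ i, c i * β v.1 (s i).1 :=
        (congrArg (fun u => β v.1 (Prod.fst u)) hv.symm).trans (by simp [Prod.fst_sum])
      have h2 : v.2 * v.2 = ∑ i, c i * (v.2 * (s i).2) :=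
        (congrArg (fun u => v.2 * Prod.snd u) hv.symm).trans
          (by simp [Prod.snd_sum, Finset.mul_sum, mul_left_comm])
      rw [h1, h2, ← Finset.sum_add_distrib]
      exact Finset.sum_congr rfl fun i _ => mul_add _ _ _
    have hne : ∑ j, c j • s j ≠ 0 := fun h0 =>
      hc (funext (Fintype.linearIndependent_iff.1 hs c h0))
    rw [heq]
    by_cases h1 : (∑ j, c j • s j).1 = 0
    · have h2 : (∑ j, c j • s j).2 ≠ 0 := fun h2 => hne (Prod.ext h1 h2)
      rw [h1, map_zero, zero_add]
      exact mul_self_pos.2 h2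
    · exact add_pos_of_pos_of_nonneg (hpos _ h1) (mul_self_nonneg _)

/-- If the rows of `A` orthonormalise a basis of `V × ℝ`, the projections to `V` of the resulting
orthonormal basis form a Parseval frame. -/
lemma parseval_of_mul_stabilizedGram_mul_transpose [DecidableEq ι] (hβ : ∀ v w, β v w = β w v)
    (s : Basis ι ℝ (V × ℝ)) {A : Matrix ι ι ℝ} (hA : A * stabilizedGram β s * Aᵀ = 1) (v : V) :
    ∑ i, β v (∑ j, A i j • (s j).1) • ∑ j, A i j • (s j).1 = v := by
  let c : ι → ℝ := s.repr (v, 0)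
  have hc : ∑ j, c j • s j = (v, 0) := s.sum_repr _
  have hcancel : Aᵀ *ᵥ (A *ᵥ (stabilizedGram β s *ᵥ c)) = c := by
    rw [mulVec_mulVec, mulVec_mulVec, Matrix.mul_assoc, mul_eq_one_comm.1 hA, one_mulVec]
  have hinner : ∀ i, β v (∑ j, A i j • (s j).1) = (A *ᵥ (stabilizedGram β s *ᵥ c)) i := fun i => by
    rw [map_sum]
    refine Finset.sum_congr rfl fun j _ => ?_
    rw [stabilizedGram_mulVec β hβ, hc, zero_mul, add_zero, map_smul, smul_eq_mul]
  calc ∑ i, β v (∑ j, A i j • (s j).1) • ∑ j, A i j • (s j).1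
      = ∑ j, (Aᵀ *ᵥ (A *ᵥ (stabilizedGram β s *ᵥ c))) j • (s j).1 := by
        simp only [hinner, Finset.smul_sum, smul_smul]
        rw [Finset.sum_comm]
        refine Finset.sum_congr rfl fun j _ => ?_
        rw [← Finset.sum_smul]
        exact congrArg (· • (s j).1) (Finset.sum_congr rfl fun i _ => mul_comm _ _)
    _ = v := by
        rw [hcancel]
        simpa [Prod.fst_sum] using congrArg Prod.fst hc

end StabilizedGram

variable {n : ℕ} (σ : Fin n → V)

/-- The synthesis map of a finite family of vectors: coefficients are sent to the corresponding
linear combination. -/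
def frameSynthesis : EuclideanSpace ℝ (Fin n) →ₗ[ℝ] V where
  toFun y := ∑ j, y j • σ j
  map_add' y z := by simp [add_smul, Finset.sum_add_distrib]
  map_smul' c y := by simp [smul_smul, Finset.smul_sum]

/-- The analysis map of a finite family of vectors: a vector is sent to its products with the
members of the family. -/
def frameAnalysis : V →ₗ[ℝ] EuclideanSpace ℝ (Fin n) where
  toFun v := WithLp.toLp 2 fun j => β v (σ j)
  map_add' v w := by ext j; simp
  map_smul' c v := by ext j; simp

lemma inner_frameAnalysis (v : V) (y : EuclideanSpace ℝ (Fin n)) :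
    inner ℝ y (frameAnalysis β σ v) = β v (frameSynthesis σ y) := by
  simp [frameSynthesis, frameAnalysis, PiLp.inner_apply, mul_comm]

variable {β σ}

/-- A Parseval frame with one more member than the dimension has a one-dimensional space of linear
relations, and the projection to it is the complement of the projection to the range of the
analysis map. -/
lemma exists_unit_relation (hσ : ∀ v, ∑ j, β v (σ j) • σ j = v) (hn : n = finrank ℝ V + 1) :
    ∃ w : EuclideanSpace ℝ (Fin n), ‖w‖ = 1 ∧ frameSynthesis σ w = 0 ∧
      ∀ y, rankOne ℝ w w y = y - frameAnalysis β σ (frameSynthesis σ y) := by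
  have hST : ∀ v, frameSynthesis σ (frameAnalysis β σ v) = v := hσ
  have hrank : finrank ℝ (LinearMap.ker (frameSynthesis σ)) = 1 := by
    have h1 := (frameSynthesis σ).finrank_range_add_finrank_ker
    rw [LinearMap.range_eq_top.2 fun v => ⟨_, hST v⟩, finrank_top, finrank_euclideanSpace_fin] at h1
    omega
  obtain ⟨⟨v, hvS⟩, hv0, hv⟩ := finrank_eq_one_iff'.1 hrank
  rw [LinearMap.mem_ker] at hvS
  have hv0' : ‖v‖ ≠ 0 := norm_ne_zero_iff.2 fun h => hv0 (Subtype.ext h)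
  refine ⟨‖v‖⁻¹ • v, ?_, ?_, fun y => ?_⟩
  · rw [norm_smul, norm_inv, norm_norm, inv_mul_cancel₀ hv0']
  · rw [map_smul, hvS, smul_zero]
  · obtain ⟨c, hc⟩ := hv ⟨y - frameAnalysis β σ (frameSynthesis σ y), by
      rw [LinearMap.mem_ker, map_sub, hST, sub_self]⟩
    have hc' : c • v = y - frameAnalysis β σ (frameSynthesis σ y) := congrArg Subtype.val hc
    have hvy : inner ℝ v y = c * (‖v‖ * ‖v‖) := by
      rw [← real_inner_self_eq_norm_mul_norm, ← real_inner_smul_right, hc', inner_sub_right,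
        inner_frameAnalysis, hvS, map_zero, sub_zero]
    rw [← hc', rankOne_apply, real_inner_smul_left, hvy, smul_smul]
    congr 1
    field_simp

/-- A Parseval frame and a unit vector spanning the orthogonal complement of the range of its
analysis map identify `V × ℝ` with Euclidean space. -/
noncomputable def stabilizationEquiv (hσ : ∀ v, ∑ j, β v (σ j) • σ j = v)
    {w : EuclideanSpace ℝ (Fin n)} (hw : ‖w‖ = 1) (hSw : frameSynthesis σ w = 0)
    (hrank : ∀ y, rankOne ℝ w w y = y - frameAnalysis β σ (frameSynthesis σ y)) :
    (V × ℝ) ≃ₗ[ℝ] EuclideanSpace ℝ (Fin n) where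
  toFun v := frameAnalysis β σ v.1 + v.2 • w
  map_add' v v' := by simp only [Prod.fst_add, Prod.snd_add, map_add, add_smul]; abel
  map_smul' c v := by simp [smul_smul]
  invFun y := (frameSynthesis σ y, inner ℝ w y)
  left_inv v := by
    have hST : frameSynthesis σ (frameAnalysis β σ v.1) = v.1 := hσ v.1
    simp [hST, hSw, inner_add_right, inner_frameAnalysis, inner_smul_right, hw]
  right_inv y := by
    have := hrank y
    rw [rankOne_apply] at this
    simp [this]

end LinearAlgebra

/-! ### Parseval frames and stable trivialisations -/

section Frames

open Bundle Topology InnerProductSpace Matrix Module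

variable {EN : Type*} [NormedAddCommGroup EN] [NormedSpace ℝ EN] {HN : Type*} [TopologicalSpace HN]
  {IN : ModelWithCorners ℝ EN HN} {N : Type*} [TopologicalSpace N] [ChartedSpace HN N]
  {r : ℕ∞ω}

/-- A continuous unit generator of a smooth line field is smooth: near `x₀`, it is the normalised
projection to the lines of its value at `x₀`. -/
lemma LineFieldLift.contMDiff {E : Type*} [NormedAddCommGroup E] [InnerProductSpace ℝ E]
    {w u : N → E} (hw : ∀ x, ‖w x‖ = 1) (hu : LineFieldLift w u)
    (hs : ∀ y, ContMDiff IN 𝓘(ℝ, E) r fun x => rankOne ℝ (w x) (w x) y) :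
    ContMDiff IN 𝓘(ℝ, E) r u := by
  intro x₀
  have hu1 := hu.norm_eq_one hw
  let f : N → E := fun x => rankOne ℝ (w x) (w x) (u x₀)
  have hfu : ∀ x, f x = inner ℝ (u x) (u x₀) • u x := fun x => by
    rcases hu.eq_or_neg x with h | h <;> simp only [f, rankOne_apply, h, inner_neg_left, neg_smul_neg]
  have hpos : ∀ᶠ x in 𝓝 x₀, 0 < inner ℝ (u x) (u x₀) :=
    (hu.continuous.inner continuous_const).continuousAt.eventually_const_lt (by simp [hu1])
  have hf0 : f x₀ ≠ 0 := by
    rw [hfu, ← norm_ne_zero_iff]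
    simp [hu1]
  have hnorm : ContMDiffAt IN 𝓘(ℝ, ℝ) r (fun x => ‖f x‖) x₀ :=
    (contDiffAt_norm ℝ hf0).contMDiffAt.comp (g := norm) x₀ (hs (u x₀) x₀)
  refine ((hnorm.inv₀ (norm_ne_zero_iff.2 hf0)).smul (hs (u x₀) x₀)).congr_of_eventuallyEq ?_
  filter_upwards [hpos] with x hx
  change u x = ‖f x‖⁻¹ • f x
  rw [hfu, norm_smul, hu1, mul_one, Real.norm_of_nonneg hx.le, smul_smul, inv_mul_cancel₀ hx.ne',
    one_smul]

variable {d : ℕ} {M : Type*} [TopologicalSpace M] [ChartedSpace (EuclideanSpace ℝ (Fin d)) M]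
  [IsManifold (𝓡 d) ∞ M] (g : RiemannianMetricOn d M)

lemma contMDiff_riemannianMetric {b : N → M} {v w : ∀ m, TangentSpace (𝓡 d) (b m)}
    (hv : ContMDiff IN (𝓡 d).tangent ∞ (fun m => (⟨b m, v m⟩ : TangentBundle (𝓡 d) M)))
    (hw : ContMDiff IN (𝓡 d).tangent ∞ (fun m => (⟨b m, w m⟩ : TangentBundle (𝓡 d) M))) :
    ContMDiff IN 𝓘(ℝ, ℝ) ∞ (fun m => g.inner (b m) (v m) (w m)) := by
  have hb : ContMDiff IN (𝓡 d) ∞ b := fun m => (contMDiffAt_totalSpace.1 (hv m)).1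
  have h : ContMDiff IN ((𝓡 d).prod 𝓘(ℝ, ℝ)) ∞ (fun m =>
      TotalSpace.mk' ℝ (E := Bundle.Trivial M ℝ) (b m) (g.inner (b m) (v m) (w m))) :=
    ContMDiff.clm_bundle_apply₂ (F₁ := EuclideanSpace ℝ (Fin d)) (F₂ := EuclideanSpace ℝ (Fin d))
      (g.contMDiff.comp hb) hv hw
  exact ((contMDiff_trivialBundle_iff _).1 h).2

/-- The tangential parts of a smooth orthonormal frame of `TM ⊕ ℝ` form a Parseval frame. -/
theorem StablyParallelizable.admitsParsevalFrame (h : StablyParallelizable d M) :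
    AdmitsParsevalFrame g (d + 1) := by
  obtain ⟨e, he⟩ := h.exists_linearEquiv
  let b : Basis (Fin (d + 1)) ℝ (EuclideanSpace ℝ (Fin d) × ℝ) :=
    finBasisOfFinrankEq ℝ _ (by simp)
  let s : ∀ x, Basis (Fin (d + 1)) ℝ (TangentSpace (𝓡 d) x × ℝ) := fun x => b.map (e x).symm
  have hs := fun j => (contMDiff_prodBundle_iff _).1 (he (b j))
  have hp : ∀ j, ContMDiff (𝓡 d) (𝓡 d).tangent ∞
      (fun x => (⟨x, (s x j).1⟩ : TangentBundle (𝓡 d) M)) := fun j => by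
    simpa only [s, Basis.map_apply] using (hs j).1
  have ht : ∀ j, ContMDiff (𝓡 d) 𝓘(ℝ, ℝ) ∞ (fun x => (s x j).2) := fun j => by
    simpa only [s, Basis.map_apply] using ((contMDiff_trivialBundle_iff _).1 (hs j).2).2
  obtain ⟨A, hA, hAG⟩ := exists_contMDiff_mul_mul_transpose_eq_one
    (G := fun x => stabilizedGram (g.inner x).toLinearMap₁₂ (s x))
    (fun i j => (contMDiff_riemannianMetric g (hp i) (hp j)).add ((ht i).mul (ht j)))
    (fun x => posDef_stabilizedGram _ (g.symm x) (g.pos x) (s x).linearIndependent)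
  refine ⟨fun i x => ∑ j, A x i j • (s x j).1, fun i => ?_, fun x v => ?_⟩
  · exact contMDiff_sum_smul_bundle _ contMDiff_id (fun j _ => hA i j) fun j _ => hp j
  · exact parseval_of_mul_stabilizedGram_mul_transpose _ (g.symm x) (s x) (hAG x) v

/-- A Parseval frame of size `d + 1` embeds `TM` isometrically into the trivial bundle of rank
`d + 1`. When `H¹(M; ℤ/2)` vanishes, the orthogonal complement, a line bundle, has a smooth unit
section, so that `TM ⊕ ℝ` is identified with the trivial bundle. -/
theorem AdmitsParsevalFrame.stablyParallelizable (h : AdmitsParsevalFrame g (d + 1))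
    (hM : Subsingleton (SingularCohomology (ZMod 2) M 1)) : StablyParallelizable d M := by
  obtain ⟨σ, hσ, hpars⟩ := h
  have hrel := fun x => exists_unit_relation (β := (g.inner x).toLinearMap₁₂)
    (σ := fun j => σ j x) (hpars x)
    (congrArg (· + 1) (finrank_euclideanSpace_fin (𝕜 := ℝ) (n := d)).symm)
  choose w hw hSw hrank using hrel
  have hsmooth : ∀ y, ContMDiff (𝓡 d) 𝓘(ℝ, EuclideanSpace ℝ (Fin (d + 1))) ∞
      fun x => rankOne ℝ (w x) (w x) y := fun y => by
    have hS : ContMDiff (𝓡 d) (𝓡 d).tangent ∞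
        (fun x => (⟨x, ∑ i, y i • σ i x⟩ : TangentBundle (𝓡 d) M)) :=
      contMDiff_sum_smul_bundle _ contMDiff_id (fun i _ => contMDiff_const) fun i _ => hσ i
    simp only [hrank]
    exact contMDiff_const.sub (PiLp.contDiff_toLp.contMDiff.comp
      (contMDiff_pi_space.2 fun j => contMDiff_riemannianMetric g hS (hσ j)))
  have : LocallyPathConnectedSpace M :=
    ChartedSpace.locallyPathConnectedSpace (EuclideanSpace ℝ (Fin d)) M
  obtain ⟨ν, hν⟩ := exists_lineFieldLift_of_subsingleton_singularCohomology hw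
    (continuous_clm_apply.2 fun y => (hsmooth y).continuous) hM
  have hνs := hν.contMDiff hw hsmooth
  have hSν : ∀ x, frameSynthesis (fun j => σ j x) (ν x) = 0 := fun x => by
    rcases hν.eq_or_neg x with h | h <;> simp [h, hSw]
  have hνrank : ∀ x y, rankOne ℝ (ν x) (ν x) y =
      y - frameAnalysis (g.inner x).toLinearMap₁₂ (fun j => σ j x)
        (frameSynthesis (fun j => σ j x) y) := fun x y => by
    rw [← hrank]
    rcases hν.eq_or_neg x with h | h <;> simp only [rankOne_apply, h, inner_neg_left, neg_smul_neg]
  let Φ : EuclideanSpace ℝ (Fin (d + 1)) ≃L[ℝ] (EuclideanSpace ℝ (Fin d) × ℝ) :=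
    ContinuousLinearEquiv.ofFinrankEq (by simp)
  refine isTrivialVectorBundle_of_linearEquiv (fun x =>
    (stabilizationEquiv (hpars x) (hν.norm_eq_one hw x) (hSν x) (hνrank x)).trans Φ.toLinearEquiv)
    ?_ ?_
  · have hid := (contMDiff_prodBundle_iff (n := ∞) (IB := 𝓡 d)
      (id : TotalSpace (EuclideanSpace ℝ (Fin d) × ℝ)
        ((TangentSpace (𝓡 d) : M → Type _) ×ᵇ Bundle.Trivial M ℝ) → _)).1 contMDiff_id
    have hproj := ((contMDiff_trivialBundle_iff _).1 hid.2).1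
    have hT := (PiLp.contDiff_toLp (p := 2) (𝕜 := ℝ) (n := ∞)).contMDiff.comp
      (contMDiff_pi_space.2 fun j => contMDiff_riemannianMetric g hid.1 ((hσ j).comp hproj))
    have hν' := ((contMDiff_trivialBundle_iff _).1 hid.2).2.smul (hνs.comp hproj)
    exact Φ.contDiff.contMDiff.comp (hT.add hν')
  · have hy : ContMDiff ((𝓡 d).prod 𝓘(ℝ, EuclideanSpace ℝ (Fin d) × ℝ))
        𝓘(ℝ, EuclideanSpace ℝ (Fin (d + 1))) ∞
        (fun q : M × (EuclideanSpace ℝ (Fin d) × ℝ) => Φ.symm q.2) :=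
      Φ.symm.contDiff.contMDiff.comp contMDiff_snd
    have hS : ContMDiff ((𝓡 d).prod 𝓘(ℝ, EuclideanSpace ℝ (Fin d) × ℝ)) (𝓡 d).tangent ∞
        (fun q : M × (EuclideanSpace ℝ (Fin d) × ℝ) =>
          (⟨q.1, ∑ i, Φ.symm q.2 i • σ i q.1⟩ : TangentBundle (𝓡 d) M)) :=
      contMDiff_sum_smul_bundle _ contMDiff_fst
        (fun i _ => (contDiff_piLp_apply (p := 2) (i := i)).contMDiff.comp hy)
        fun i _ => (hσ i).comp contMDiff_fst
    exact (contMDiff_prodBundle_iff _).2 ⟨hS, (contMDiff_trivialBundle_iff _).2 ⟨contMDiff_fst,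
      contDiff_inner.contMDiff.comp ((hνs.comp contMDiff_fst).prodMk_space hy)⟩⟩

end Frames

theorem mainTheorem4 (d : ℕ) (M : Type*) [TopologicalSpace M] [T2Space M]
    [SecondCountableTopology M] [ChartedSpace (EuclideanSpace ℝ (Fin d)) M]
    [IsManifold (𝓡 d) ∞ M] (g : RiemannianMetricOn d M) :
    (StablyParallelizable d M → AdmitsParsevalFrame g (d + 1)) ∧
      (Subsingleton (SingularCohomology (ZMod 2) M 1) →
        AdmitsParsevalFrame g (d + 1) → StablyParallelizable d M) :=
  ⟨StablyParallelizable.admitsParsevalFrame g,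
    fun hM h => AdmitsParsevalFrame.stablyParallelizable g h hM⟩
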